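/- **Notation.** For positive reals $\lambda_1,\dots,\lambda_N$ (the capacities of $N$ nodes; they may depend on $N$) put $$\mu_N=\frac1N\sum_{i=1}^N\lambda_i,\qquad \nu_N=\frac{\sum_{i=1}^N\lambda_i^2}{\sum_{i=1}^N\lambda_i},\qquad f^{(N)}_n=\frac1N\sum_{i=1}^N e^{-\lambda_i}\frac{\lambda_i^n}{n!},\qquad g^{(N)}_n=\frac1{N\mu_N}\sum_{i=1}^N e^{-\lambda_i}\frac{\lambda_i^{n+1}}{n!}\quad(n\ge 0),$$ and $d_{\mathrm{TV}}(p,q)=\frac12\sum_{n\ge0}|p_n-q_n|$. Consider the following conditions on a family of capacities, as $N\to\infty$. * **(C1)** with limits $\mu\in(0,\infty)$, $\nu\in(1,\infty)$ and exponent $\alpha_1>0$: $|\mu_N-\mu|=O(N^{-\alpha_1})$ and $|\nu_N-\nu|=O(N^{-\alpha_1})$. * **(C2)** with limiting probability mass functions $f,g$ on $\{0,1,2,\dots\}$ and exponent $\alpha_2>0$: $d_{\mathrm{TV}}(f^{(N)},f)=O(N^{-\alpha_2})$ and $d_{\mathrm{TV}}(g^{(N)},g)=O(N^{-\alpha_2})$.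 * **(C3)** with exponent $\tau'>3$: for every $\varepsilon>0$ such that $\gamma:=\frac1{\tau'-1}+\varepsilon<\frac12$, $$\limsup_{N\to\infty}\frac1N\sum_{i=1}^N\lambda_i^{\tau'-1-\varepsilon}<\infty\qquad\text{and}\qquad \max_{1\le i\le N}\lambda_i\le N^{\gamma}\ \text{ for all large } N.\tag{1}$$ **Theorem 1.4.** Let $\Lambda,\Lambda_1,\Lambda_2,\dots$ be i.i.d. positive random variables with distribution function $F_\Lambda$, and suppose that there are constants $c>0$ and $\tau>3$ such that $1-F_\Lambda(x)\le c\,x^{1-\tau}$ for all $x>0$. Put $$\mu=\mathbb E[\Lambda],\qquad \nu=\frac{\mathbb E[\Lambda^2]}{\mathbb E[\Lambda]},\qquad f_n=\mathbb E\Big[e^{-\Lambda}\frac{\Lambda^n}{n!}\Big],\qquad g_n=\frac1\mu\,\mathbb E\Big[e^{-\Lambda}\frac{\Lambda^{n+1}}{n!}\Big]\quad(n\ge0),$$ and suppose that $\nu>1$. Then there are $\alpha_1,\alpha_2>0$ such that the following holds. 1. For every $\tau'\in(3,\tau)$ there are $\beta>0$ and measurable sets $\mathcal J_N\subseteq\mathbb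 R^N$ with $$\mathbb P\big((\Lambda_1,\dots,\Lambda_N)\in\mathcal J_N\big)=1-O(N^{-\beta})$$ such that every family of positive capacities with $(\lambda_1,\dots,\lambda_N)\in\mathcal J_N$ for all large $N$ satisfies (C1) with limits $\mu,\nu$ and exponent $\alpha_1$, (C2) with limits $f,g$ and exponent $\alpha_2$, and (C3) with exponent $\tau'$. 2. For every fixed $\varepsilon>0$ with $\frac1{\tau-1}+\varepsilon<\frac12$ there are $\beta>0$ and measurable sets $\mathcal J_N\subseteq\mathbb R^N$ with the same probability bound such that every family of positive capacities with $(\lambda_1,\dots,\lambda_N)\in\mathcal J_N$ for all large $N$ satisfies (C1) and (C2) as in part 1, and the two bounds (1) for the original exponent $\tau$ (that is, with $\tau'=\tau$) and this $\varepsilon$. -/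

import Mathlib

open MeasureTheory ProbabilityTheory Filter Asymptotics

noncomputable section

namespace CapacityGraph

/-- A triangular array of capacities: for every number `N` of nodes, the capacities
`λ_1, …, λ_N` (indexed here by `Fin N`), which may change with `N`. -/
abbrev Capacities : Type := (N : ℕ) → Fin N → ℝ

/-- `μ_N = (1/N) ∑ λ_i`. -/
def meanN {N : ℕ} (x : Fin N → ℝ) : ℝ := (1 / (N : ℝ)) * ∑ i, x i

/-- `ν_N = ∑ λ_i² / ∑ λ_i`. -/
def nuN {N : ℕ} (x : Fin N → ℝ) : ℝ := (∑ i, x i ^ 2) / ∑ i, x i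

/-- `f_n^{(N)} = (1/N) ∑ e^{-λ_i} λ_i^n / n!`. -/
def fN {N : ℕ} (x : Fin N → ℝ) (n : ℕ) : ℝ :=
  (1 / (N : ℝ)) * ∑ i, Real.exp (-x i) * x i ^ n / (n.factorial : ℝ)

/-- `g_n^{(N)} = (1/(N μ_N)) ∑ e^{-λ_i} λ_i^{n+1} / n!`. -/
def gN {N : ℕ} (x : Fin N → ℝ) (n : ℕ) : ℝ :=
  (1 / ((N : ℝ) * meanN x)) * ∑ i, Real.exp (-x i) * x i ^ (n + 1) / (n.factorial : ℝ)

/-- `p` is a probability mass function on `{0, 1, 2, …}`. -/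
def IsProbMass (p : ℕ → ℝ) : Prop := (∀ n, 0 ≤ p n) ∧ HasSum p 1

/-- The total variation distance of two probability mass functions on `{0, 1, 2, …}`. -/
def dTV (p q : ℕ → ℝ) : ℝ := (1 / 2) * ∑' n, |p n - q n|

/-- Convergence of means, with limits `μ`, `ν` and rate exponent `α`. -/
def CondC1 (lam : Capacities) (μ ν α : ℝ) : Prop :=
  0 < μ ∧ 1 < ν ∧ 0 < α ∧
    (fun N : ℕ => |meanN (lam N) - μ|) =O[atTop] (fun N : ℕ => (N : ℝ) ^ (-α)) ∧
    (fun N : ℕ => |nuN (lam N) - ν|) =O[atTop] (fun N : ℕ => (N : ℝ) ^ (-α))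

/-- Convergence of the offspring laws, with limit laws `f`, `g` and rate exponent `α`.
That `f` and `g` are probability mass functions is part of the condition, so for positive
capacities and `N ≥ 1` the series in `dTV` converge. -/
def CondC2 (lam : Capacities) (f g : ℕ → ℝ) (α : ℝ) : Prop :=
  IsProbMass f ∧ IsProbMass g ∧ 0 < α ∧
    (fun N : ℕ => dTV (fN (lam N)) f) =O[atTop] (fun N : ℕ => (N : ℝ) ^ (-α)) ∧
    (fun N : ℕ => dTV (gN (lam N)) g) =O[atTop] (fun N : ℕ => (N : ℝ) ^ (-α))

/-- The moment bound and the bound on the maximal capacity, for one pair `(τ, ε)`: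
`limsup (1/N) ∑ λ_i^{τ-1-ε} < ∞`, and `max_i λ_i ≤ N^γ` for all large `N`, where
`γ = 1/(τ-1) + ε`. The limsup is taken in the extended reals. -/
def CondC3At (lam : Capacities) (τ ε : ℝ) : Prop :=
  limsup (fun N : ℕ => (((1 / (N : ℝ)) * ∑ i, lam N i ^ (τ - 1 - ε) : ℝ) : EReal)) atTop < ⊤ ∧
    ∀ᶠ N : ℕ in atTop, ∀ i : Fin N, lam N i ≤ (N : ℝ) ^ (1 / (τ - 1) + ε)

/-- The moment and maximal bound with exponent `τ > 3`: it holds for every `ε > 0` for which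
`γ = 1/(τ-1) + ε < 1/2`. -/
def CondC3 (lam : Capacities) (τ : ℝ) : Prop :=
  3 < τ ∧ ∀ ε : ℝ, 0 < ε → 1 / (τ - 1) + ε < 1 / 2 → CondC3At lam τ ε

variable {Ω : Type*} [MeasurableSpace Ω]

/-- `μ = E[Λ]`. -/
def mu (P : Measure Ω) (X : Ω → ℝ) : ℝ := ∫ ω, X ω ∂P

/-- `ν = E[Λ²] / E[Λ]`. -/
def nu (P : Measure Ω) (X : Ω → ℝ) : ℝ := (∫ ω, X ω ^ 2 ∂P) / ∫ ω, X ω ∂P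

/-- The mixed Poisson law `f_n = E[e^{-Λ} Λ^n / n!]`. -/
def fLim (P : Measure Ω) (X : Ω → ℝ) (n : ℕ) : ℝ :=
  ∫ ω, Real.exp (-X ω) * X ω ^ n / (n.factorial : ℝ) ∂P

/-- The size-biased mixed Poisson law `g_n = (1/μ) E[e^{-Λ} Λ^{n+1} / n!]`. -/
def gLim (P : Measure Ω) (X : Ω → ℝ) (n : ℕ) : ℝ :=
  (1 / mu P X) * ∫ ω, Real.exp (-X ω) * X ω ^ (n + 1) / (n.factorial : ℝ) ∂P

/-- The events `{(Λ_1, …, Λ_N) ∈ J_N}` have probability `1 - O(N^{-β})`. The random variables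
`Λ_1, Λ_2, …` are written `L 0, L 1, …`. -/
def HasProbOneSubPoly (P : Measure Ω) (L : ℕ → Ω → ℝ)
    (J : (N : ℕ) → Set (Fin N → ℝ)) (β : ℝ) : Prop :=
  (∀ N, MeasurableSet (J N)) ∧
    (fun N : ℕ => 1 - P.real {ω | (fun i : Fin N => L i ω) ∈ J N})
      =O[atTop] (fun N : ℕ => (N : ℝ) ^ (-β))

/-- Every array of positive capacities with `(λ_1, …, λ_N) ∈ J_N` for all large `N` has the
property `Q`. (Only large `N` matter, so an empty `J_N` for some small `N` does not make this
void; as all such arrays are considered, the bounds that `Q` gives are uniform over `J_N`.) -/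
def HoldsOn (J : (N : ℕ) → Set (Fin N → ℝ)) (Q : Capacities → Prop) : Prop :=
  ∀ lam : Capacities, (∀ N i, 0 < lam N i) → (∀ᶠ N : ℕ in atTop, lam N ∈ J N) → Q lam

end CapacityGraph

end

/-!
Truncate at level `N`: a power of `Λ` with a moment of order `s ∈ (1, 2]` has truncations of
variance `O(N^{2-s})` and bias `O(N^{1-s})`, and the truncation changes one of the `N` samples only
with probability `O(N^{1-s})`. Chebyshev's inequality then gives a law of large numbers with
polynomial rate, which controls the first two empirical moments and hence `μ_N` and `ν_N`.

The offspring laws are averages of Poisson weights. Chebyshev's inequality and a union bound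
control the first `⌈N^r⌉` of these averages at once, and Markov's inequality bounds the remaining
mass by `N^{-r}` times a moment, since a Poisson law has mean equal to its parameter. For the
size-biased law the moment is the second one.

The bound on the maximum is a union bound over the tail of `Λ`.
-/

noncomputable section

namespace CapacityGraph

lemma isBigO_natCast_rpow_neg_of_le {a b : ℝ} (hab : a ≤ b) :
    (fun N : ℕ => (N : ℝ) ^ (-b)) =O[atTop] fun N : ℕ => (N : ℝ) ^ (-a) := by
  refine .of_norm_eventuallyLE ?_
  filter_upwards [eventually_ge_atTop 1] with N hN
  rw [Real.norm_of_nonneg (by positivity)]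
  exact Real.rpow_le_rpow_of_exponent_le (by exact_mod_cast hN) (neg_le_neg hab)

lemma tendsto_natCast_rpow_neg {a : ℝ} (ha : 0 < a) :
    Tendsto (fun N : ℕ => (N : ℝ) ^ (-a)) atTop (nhds 0) :=
  (tendsto_rpow_neg_atTop ha).comp tendsto_natCast_atTop_atTop

lemma isBigO_one_of_isBigO_sub_const {u r : ℕ → ℝ} {m : ℝ}
    (hu : (fun N => u N - m) =O[atTop] r) (hr : Tendsto r atTop (nhds 0)) :
    u =O[atTop] fun _ => (1 : ℝ) := by
  simpa using (hu.trans (hr.isBigO_one ℝ)).add (isBigO_const_const m one_ne_zero atTop)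

lemma isBigO_div_sub_div {ι : Type*} {l : Filter ι} {u v r : ι → ℝ} {a b : ℝ} (hb : b ≠ 0)
    (hu : (fun i => u i - a) =O[l] r) (hv : (fun i => v i - b) =O[l] r)
    (hr : Tendsto r l (nhds 0)) :
    (fun i => u i / v i - a / b) =O[l] r := by
  have hvb : Tendsto v l (nhds b) := by
    simpa using (hv.trans_tendsto hr).add_const b
  have hinv : (fun i => (v i)⁻¹) =O[l] fun _ => (1 : ℝ) := (hvb.inv₀ hb).isBigO_one ℝ
  have hmul := hinv.mul (hu.sub (hv.const_mul_left (a / b)))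
  simp only [one_mul] at hmul
  refine hmul.congr' ?_ EventuallyEq.rfl
  filter_upwards [hvb.eventually_ne hb] with i hi
  field_simp
  ring

section HighProbability

variable {Ω : Type*} [MeasurableSpace Ω] {P : Measure Ω} {L : ℕ → Ω → ℝ}

lemma hasProbOneSubPoly_iff_isBigO_notMem [IsProbabilityMeasure P]
    (hL : ∀ i, AEMeasurable (L i) P)
    {J : (N : ℕ) → Set (Fin N → ℝ)} {β : ℝ} :
    HasProbOneSubPoly P L J β ↔ (∀ N, MeasurableSet (J N)) ∧
      (fun N : ℕ => P.real {ω | (fun i : Fin N => L i ω) ∉ J N})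
        =O[atTop] fun N : ℕ => (N : ℝ) ^ (-β) := by
  refine and_congr_right fun hJ => ?_
  have hcompl (N : ℕ) : 1 - P.real {ω | (fun i : Fin N => L i ω) ∈ J N} =
      P.real {ω | (fun i : Fin N => L i ω) ∉ J N} :=
    (probReal_compl_eq_one_sub₀
      ((aemeasurable_pi_lambda _ fun i : Fin N => hL i).nullMeasurable (hJ N))).symm
  simp only [hcompl]

/-- `Q` holds for all arrays of positive capacities that are eventually in suitable events of
probability `1 - O(N^{-β})`, for some `β > 0`. This is the form of both parts of the theorem. -/
def HoldsWithHighProb (P : Measure Ω) (L : ℕ → Ω → ℝ) (Q : Capacities → Prop) : Prop :=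
  ∃ (J : (N : ℕ) → Set (Fin N → ℝ)) (β : ℝ), 0 < β ∧ HasProbOneSubPoly P L J β ∧ HoldsOn J Q

namespace HoldsWithHighProb

variable {Q Q' : Capacities → Prop}

lemma of_measureReal_notMem_le [IsProbabilityMeasure P] (hL : ∀ i, AEMeasurable (L i) P)
    {J : (N : ℕ) → Set (Fin N → ℝ)} (hJ : ∀ N, MeasurableSet (J N)) {β : ℝ} (hβ : 0 < β) (C : ℝ)
    (hC : ∀ᶠ N : ℕ in atTop,
      P.real {ω | (fun i : Fin N => L i ω) ∉ J N} ≤ C * (N : ℝ) ^ (-β)) :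
    HoldsWithHighProb P L fun lam => ∀ᶠ N in atTop, lam N ∈ J N := by
  refine ⟨J, β, hβ, (hasProbOneSubPoly_iff_isBigO_notMem hL).2 ⟨hJ, .of_bound C ?_⟩,
    fun _ _ hmem => hmem⟩
  filter_upwards [hC] with N hN
  rwa [Real.norm_of_nonneg measureReal_nonneg, Real.norm_of_nonneg (by positivity)]

lemma mono (h : HoldsWithHighProb P L Q)
    (hQ : ∀ lam : Capacities, (∀ N i, 0 < lam N i) → Q lam → Q' lam) :
    HoldsWithHighProb P L Q' :=
  let ⟨J, β, hβ, hJ, hJQ⟩ := h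
  ⟨J, β, hβ, hJ, fun lam hlam hmem => hQ lam hlam (hJQ lam hlam hmem)⟩

lemma and [IsProbabilityMeasure P] (hL : ∀ i, AEMeasurable (L i) P) (h : HoldsWithHighProb P L Q)
    (h' : HoldsWithHighProb P L Q') : HoldsWithHighProb P L fun lam => Q lam ∧ Q' lam := by
  obtain ⟨J, β, hβ, hJ, hJQ⟩ := h
  obtain ⟨J', β', hβ', hJ', hJQ'⟩ := h'
  rw [hasProbOneSubPoly_iff_isBigO_notMem hL] at hJ hJ'
  refine ⟨fun N => J N ∩ J' N, min β β', lt_min hβ hβ',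
    (hasProbOneSubPoly_iff_isBigO_notMem hL).2 ⟨fun N => (hJ.1 N).inter (hJ'.1 N), ?_⟩,
    fun lam hlam hmem => ⟨hJQ lam hlam (hmem.mono fun _ hN => hN.1),
      hJQ' lam hlam (hmem.mono fun _ hN => hN.2)⟩⟩
  refine .trans (.of_norm_le fun N => ?_)
    ((hJ.2.trans (isBigO_natCast_rpow_neg_of_le (min_le_left β β'))).add
      (hJ'.2.trans (isBigO_natCast_rpow_neg_of_le (min_le_right β β'))))
  rw [Real.norm_of_nonneg measureReal_nonneg]
  refine (measureReal_mono fun ω hω => ?_).trans (measureReal_union_le _ _)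
  exact not_and_or.1 hω

end HoldsWithHighProb

end HighProbability

section Truncation

variable {Ω : Type*} {Y : Ω → ℝ} {s A : ℝ}

lemma sq_truncation_le (hs0 : 0 ≤ s) (hs2 : s ≤ 2) (hA : 0 ≤ A) (ω : Ω) :
    truncation Y A ω ^ 2 ≤ A ^ (2 - s) * |Y ω| ^ s := by
  have hbound : |truncation Y A ω| ≤ A := by
    simpa only [abs_of_nonneg hA] using abs_truncation_le_bound Y A ω
  calc truncation Y A ω ^ 2 = |truncation Y A ω| ^ (2 - s) * |truncation Y A ω| ^ s := by
        rw [← Real.rpow_add_of_nonneg (abs_nonneg _) (by linarith) hs0, sub_add_cancel,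
          Real.rpow_two, sq_abs]
    _ ≤ A ^ (2 - s) * |Y ω| ^ s := by
        exact mul_le_mul (Real.rpow_le_rpow (abs_nonneg _) hbound (by linarith))
          (Real.rpow_le_rpow (abs_nonneg _) (abs_truncation_le_abs_self Y A ω) hs0)
          (by positivity) (by positivity)

lemma abs_truncation_sub_le (hs : 1 ≤ s) (hA : 0 < A) (ω : Ω) :
    |truncation Y A ω - Y ω| ≤ A ^ (1 - s) * |Y ω| ^ s := by
  rcases lt_or_ge |Y ω| A with hlt | hge
  · rw [truncation_eq_self hlt, sub_self, abs_zero]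
    positivity
  have hY : 0 < |Y ω| := hA.trans_le hge
  calc |truncation Y A ω - Y ω| ≤ |Y ω| := by
        by_cases hmem : Y ω ∈ Set.Ioc (-A) A <;> simp [truncation, hmem]
    _ = |Y ω| ^ (1 - s) * |Y ω| ^ s := by
        rw [← Real.rpow_add hY, sub_add_cancel, Real.rpow_one]
    _ ≤ A ^ (1 - s) * |Y ω| ^ s := by
        gcongr ?_ * _
        exact Real.rpow_le_rpow_of_nonpos hA hge (by linarith)

variable [MeasurableSpace Ω] {P : Measure Ω}

lemma integrable_abs_rpow_of_memLp (hs : 0 < s) (hY : MemLp Y (ENNReal.ofReal s) P) :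
    Integrable (fun ω => |Y ω| ^ s) P := by
  simpa [ENNReal.toReal_ofReal hs.le] using
    hY.integrable_norm_rpow (by simpa using hs) ENNReal.ofReal_ne_top

lemma memLp_abs_rpow {p q : ℝ} (hp : 0 < p) (hY : MemLp Y (ENNReal.ofReal q) P) :
    MemLp (fun ω => |Y ω| ^ p) (ENNReal.ofReal (q / p)) P := by
  have := hY.norm_rpow_div (ENNReal.ofReal p)
  rwa [ENNReal.toReal_ofReal hp.le, ← ENNReal.ofReal_div_of_pos hp] at this

lemma abs_integral_truncation_sub_integral_le [IsFiniteMeasure P] (hs : 1 ≤ s)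
    (hY : MemLp Y (ENNReal.ofReal s) P) (hA : 0 < A) :
    |∫ ω, truncation Y A ω ∂P - ∫ ω, Y ω ∂P| ≤ A ^ (1 - s) * ∫ ω, |Y ω| ^ s ∂P := by
  rw [← integral_sub hY.aestronglyMeasurable.integrable_truncation
    (hY.integrable (by simpa using hs)), ← integral_const_mul]
  exact (Real.norm_eq_abs _).ge.trans (norm_integral_le_of_norm_le
    ((integrable_abs_rpow_of_memLp (by linarith) hY).const_mul _)
    (ae_of_all _ (abs_truncation_sub_le hs hA)))

lemma variance_truncation_le [IsProbabilityMeasure P] (hs0 : 0 < s) (hs2 : s ≤ 2)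
    (hY : MemLp Y (ENNReal.ofReal s) P) (hA : 0 ≤ A) :
    Var[truncation Y A; P] ≤ A ^ (2 - s) * ∫ ω, |Y ω| ^ s ∂P := by
  have hT : MemLp (truncation Y A) 2 P := hY.aestronglyMeasurable.memLp_truncation
  refine (variance_le_expectation_sq hT.aestronglyMeasurable).trans ?_
  rw [← integral_const_mul]
  exact integral_mono hT.integrable_sq
    ((integrable_abs_rpow_of_memLp hs0 hY).const_mul _) (sq_truncation_le hs0.le hs2 hA)

lemma measureReal_le_abs_le_integral_rpow_div (hs : 0 < s)
    (hY : MemLp Y (ENNReal.ofReal s) P) (hA : 0 < A) :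
    P.real {ω | A ≤ |Y ω|} ≤ (∫ ω, |Y ω| ^ s ∂P) / A ^ s := by
  rw [le_div_iff₀' (by positivity)]
  have hset : {ω | A ≤ |Y ω|} = {ω | A ^ s ≤ |Y ω| ^ s} := by
    ext ω
    exact (Real.rpow_le_rpow_iff hA.le (abs_nonneg _) hs).symm
  rw [hset]
  exact mul_meas_ge_le_integral_of_nonneg (ae_of_all _ fun ω => by positivity)
    (integrable_abs_rpow_of_memLp hs hY) _

lemma memLp_of_measureReal_lt_abs_le [IsFiniteMeasure P] (hY : AEMeasurable Y P) {C κ p : ℝ}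
    (htail : ∀ t : ℝ, 0 < t → P.real {ω | t < |Y ω|} ≤ C * t ^ (-κ)) (hp : 0 < p) (hpκ : p < κ) :
    MemLp Y (ENNReal.ofReal p) P := by
  have hYp : AEStronglyMeasurable (fun ω => |Y ω| ^ p) P :=
    (hY.abs.pow_const p).aestronglyMeasurable
  suffices Integrable (fun ω => |Y ω| ^ p) P by
    rw [← integrable_norm_rpow_iff hY.aestronglyMeasurable (by simpa using hp)
      ENNReal.ofReal_ne_top, ENNReal.toReal_ofReal hp.le]
    exact this
  refine ⟨hYp, (hasFiniteIntegral_iff_ofReal (ae_of_all _ fun ω => by positivity)).2 ?_⟩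
  rw [lintegral_rpow_eq_lintegral_meas_lt_mul P (ae_of_all _ fun ω => abs_nonneg (Y ω)) hY.abs hp,
    ← Set.Ioc_union_Ioi_eq_Ioi zero_le_one]
  refine ENNReal.mul_lt_top ENNReal.ofReal_lt_top
    ((lintegral_union_le _ _ _).trans_lt (ENNReal.add_lt_top.2 ⟨?_, ?_⟩))
  · have hint : IntegrableOn (fun t : ℝ => t ^ (p - 1)) (Set.Ioc 0 1) :=
      (intervalIntegrable_iff_integrableOn_Ioc_of_le zero_le_one).1
        (intervalIntegral.intervalIntegrable_rpow' (by linarith))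
    calc _ ≤ ∫⁻ t in Set.Ioc (0 : ℝ) 1, P Set.univ * ENNReal.ofReal (t ^ (p - 1)) := by
          gcongr
          exact Set.subset_univ _
      _ = P Set.univ * ∫⁻ t in Set.Ioc (0 : ℝ) 1, ENNReal.ofReal (t ^ (p - 1)) :=
          lintegral_const_mul' _ _ (measure_ne_top _ _)
      _ < ⊤ := ENNReal.mul_lt_top (measure_lt_top _ _) hint.lintegral_lt_top
  · have hint : IntegrableOn (fun t : ℝ => C * t ^ (-κ + (p - 1))) (Set.Ioi 1) :=
      (integrableOn_Ioi_rpow_of_lt (by linarith) one_pos).const_mul C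
    refine (setLIntegral_mono' measurableSet_Ioi fun t ht => ?_).trans_lt hint.lintegral_lt_top
    have ht0 : (0 : ℝ) < t := one_pos.trans ht
    rw [← ofReal_measureReal, ← ENNReal.ofReal_mul measureReal_nonneg, Real.rpow_add ht0,
      ← mul_assoc]
    gcongr
    exact htail t ht0

end Truncation

section LawOfLargeNumbers

variable {Ω : Type*} [MeasurableSpace Ω] {P : Measure Ω} {X : ℕ → Ω → ℝ}

lemma integral_meanN (hident : ∀ i, IdentDistrib (X i) (X 0) P P) (hX : Integrable (X 0) P)
    {N : ℕ} (hN : N ≠ 0) :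
    ∫ ω, meanN (fun i : Fin N => X i ω) ∂P = ∫ ω, X 0 ω ∂P := by
  simp only [meanN]
  rw [integral_const_mul,
    integral_finsetSum Finset.univ fun (i : Fin N) _ => (hident i).integrable_iff.2 hX]
  simp only [fun i : Fin N => (hident i).integral_eq, Finset.sum_const, Finset.card_univ,
    Fintype.card_fin, nsmul_eq_mul]
  field_simp

lemma memLp_meanN {p : ENNReal} (hX : ∀ i, MemLp (X i) p P) (N : ℕ) :
    MemLp (fun ω => meanN fun i : Fin N => X i ω) p P :=
  (memLp_finsetSum Finset.univ fun (i : Fin N) _ => hX i).const_mul _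

lemma variance_meanN (hindep : Pairwise fun i j => X i ⟂ᵢ[P] X j)
    (hident : ∀ i, IdentDistrib (X i) (X 0) P P) (hX : MemLp (X 0) 2 P) (N : ℕ) :
    Var[fun ω => meanN (fun i : Fin N => X i ω); P] = Var[X 0; P] / N := by
  have hsum : Var[∑ i : Fin N, X i; P] = N * Var[X 0; P] := by
    rw [IndepFun.variance_sum (fun (i : Fin N) _ => (hident i).memLp_iff.2 hX)
      fun i _ j _ hij => hindep (Fin.val_injective.ne hij)]
    simp [fun i : Fin N => (hident i).variance_eq]
  have hmean : (fun ω => meanN (fun i : Fin N => X i ω)) =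
      fun ω => 1 / (N : ℝ) * (∑ i : Fin N, X i) ω := by
    simp only [meanN, Finset.sum_apply]
  rw [hmean, variance_const_mul, hsum]
  field_simp

lemma measureReal_le_abs_meanN_sub_integral_le_variance [IsFiniteMeasure P]
    (hindep : Pairwise fun i j => X i ⟂ᵢ[P] X j)
    (hident : ∀ i, IdentDistrib (X i) (X 0) P P) (hX : MemLp (X 0) 2 P) {N : ℕ} (hN : N ≠ 0)
    {δ : ℝ} (hδ : 0 < δ) :
    P.real {ω | δ ≤ |meanN (fun i : Fin N => X i ω) - ∫ ω, X 0 ω ∂P|} ≤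
      Var[X 0; P] / (N * δ ^ 2) := by
  have hcheb := meas_ge_le_variance_div_sq
    (memLp_meanN (fun i => (hident i).memLp_iff.2 hX) N) hδ
  rw [integral_meanN hident (hX.integrable one_le_two) hN, variance_meanN hindep hident hX,
    div_div] at hcheb
  exact ENNReal.toReal_le_of_le_ofReal
    (div_nonneg (variance_nonneg _ _) (by positivity)) hcheb

lemma measureReal_exists_fin_mem_le [IsFiniteMeasure P]
    (hident : ∀ i, IdentDistrib (X i) (X 0) P P) {B : Set ℝ} (hB : MeasurableSet B) (N : ℕ) :
    P.real {ω | ∃ i : Fin N, X i ω ∈ B} ≤ N * P.real {ω | X 0 ω ∈ B} := by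
  rw [Set.ofPred_exists]
  refine (measureReal_iUnion_fintype_le _).trans_eq ?_
  have hmem (i : Fin N) : P.real {ω | X i ω ∈ B} = P.real {ω | X 0 ω ∈ B} :=
    congrArg ENNReal.toReal ((hident i).measure_mem_eq hB)
  simp [hmem]

lemma measureReal_le_abs_meanN_truncation_sub_integral_le [IsProbabilityMeasure P]
    (hindep : Pairwise fun i j => X i ⟂ᵢ[P] X j)
    (hident : ∀ i, IdentDistrib (X i) (X 0) P P) {s : ℝ} (hs0 : 0 < s) (hs2 : s ≤ 2)
    (hX : MemLp (X 0) (ENNReal.ofReal s) P) {N : ℕ} (hN : N ≠ 0) {δ : ℝ} (hδ : 0 < δ) :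
    P.real {ω | δ ≤ |meanN (fun i : Fin N => truncation (X i) N ω) -
        ∫ ω, truncation (X 0) N ω ∂P|} ≤
      (∫ ω, |X 0 ω| ^ s ∂P) * (N : ℝ) ^ (1 - s) / δ ^ 2 := by
  have hN' : (0 : ℝ) < N := by positivity
  have hmeas : Measurable (Set.indicator (Set.Ioc (-(N : ℝ)) N) id) :=
    measurable_id.indicator measurableSet_Ioc
  calc P.real {ω | δ ≤ |meanN (fun i : Fin N => truncation (X i) N ω) -
        ∫ ω, truncation (X 0) N ω ∂P|}
    _ ≤ Var[truncation (X 0) N; P] / (N * δ ^ 2) :=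
        measureReal_le_abs_meanN_sub_integral_le_variance
          (fun _ _ hij => (hindep hij).comp hmeas hmeas) (fun i => (hident i).truncation)
          hX.aestronglyMeasurable.memLp_truncation hN hδ
    _ ≤ (N : ℝ) ^ (2 - s) * (∫ ω, |X 0 ω| ^ s ∂P) / (N * δ ^ 2) := by
        gcongr
        exact variance_truncation_le hs0 hs2 hX hN'.le
    _ = (∫ ω, |X 0 ω| ^ s ∂P) * (N : ℝ) ^ (1 - s) / δ ^ 2 := by
        rw [show 2 - s = 1 + (1 - s) by ring, Real.rpow_add hN', Real.rpow_one]
        field_simp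

lemma measureReal_lt_abs_meanN_sub_integral_le [IsProbabilityMeasure P]
    (hindep : Pairwise fun i j => X i ⟂ᵢ[P] X j)
    (hident : ∀ i, IdentDistrib (X i) (X 0) P P) {s : ℝ} (hs1 : 1 ≤ s) (hs2 : s ≤ 2)
    (hX : MemLp (X 0) (ENNReal.ofReal s) P) {N : ℕ} (hN : N ≠ 0) {δ : ℝ} (hδ : 0 < δ)
    (hNδ : 2 * ((∫ ω, |X 0 ω| ^ s ∂P) * (N : ℝ) ^ (1 - s)) ≤ δ) :
    P.real {ω | δ < |meanN (fun i : Fin N => X i ω) - ∫ ω, X 0 ω ∂P|} ≤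
      (∫ ω, |X 0 ω| ^ s ∂P) * (N : ℝ) ^ (1 - s) * (1 + 4 / δ ^ 2) := by
  have hN' : (0 : ℝ) < N := by positivity
  have hs0 : 0 < s := by linarith
  set m := ∫ ω, |X 0 ω| ^ s ∂P
  have hlarge : P.real {ω | ∃ i : Fin N, (N : ℝ) ≤ |X i ω|} ≤ m * (N : ℝ) ^ (1 - s) :=
    calc P.real {ω | ∃ i : Fin N, (N : ℝ) ≤ |X i ω|}
      _ ≤ N * P.real {ω | (N : ℝ) ≤ |X 0 ω|} :=
          measureReal_exists_fin_mem_le hident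
            (measurableSet_le measurable_const measurable_norm) N
      _ ≤ N * (m / (N : ℝ) ^ s) := by
          gcongr
          exact measureReal_le_abs_le_integral_rpow_div hs0 hX hN'
      _ = m * (N : ℝ) ^ (1 - s) := by
          rw [Real.rpow_sub hN', Real.rpow_one]
          ring
  set T : ℕ → Ω → ℝ := fun i => truncation (X i) N
  have hbias : |∫ ω, T 0 ω ∂P - ∫ ω, X 0 ω ∂P| ≤ δ / 2 := by
    have := abs_integral_truncation_sub_integral_le hs1 hX hN'
    linarith
  have htrunc := measureReal_le_abs_meanN_truncation_sub_integral_le hindep hident hs0 hs2 hX hN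
    (half_pos hδ)
  have hsubset : {ω | δ < |meanN (fun i : Fin N => X i ω) - ∫ ω, X 0 ω ∂P|} ⊆
      {ω | ∃ i : Fin N, (N : ℝ) ≤ |X i ω|} ∪
        {ω | δ / 2 ≤ |meanN (fun i : Fin N => T i ω) - ∫ ω, T 0 ω ∂P|} := by
    intro ω hω
    by_contra hnot
    simp only [Set.mem_union, Set.mem_ofPred_eq, not_or, not_exists, not_le] at hnot hω
    have hTX : (fun i : Fin N => T i ω) = fun i : Fin N => X i ω :=
      funext fun i => truncation_eq_self (hnot.1 i)
    have := abs_sub_le (meanN fun i : Fin N => X i ω) (∫ ω, T 0 ω ∂P) (∫ ω, X 0 ω ∂P)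
    rw [hTX] at hnot
    linarith [hnot.2]
  calc P.real {ω | δ < |meanN (fun i : Fin N => X i ω) - ∫ ω, X 0 ω ∂P|}
    _ ≤ m * (N : ℝ) ^ (1 - s) + m * (N : ℝ) ^ (1 - s) / (δ / 2) ^ 2 :=
        (measureReal_mono hsubset).trans
          ((measureReal_union_le _ _).trans (add_le_add hlarge htrunc))
    _ = m * (N : ℝ) ^ (1 - s) * (1 + 4 / δ ^ 2) := by
        field_simp
        norm_num

theorem eventually_measureReal_rpow_lt_abs_meanN_sub_integral_le [IsProbabilityMeasure P]
    (hindep : Pairwise fun i j => X i ⟂ᵢ[P] X j)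
    (hident : ∀ i, IdentDistrib (X i) (X 0) P P) {s a : ℝ} (hs : s ≤ 2)
    (hX : MemLp (X 0) (ENNReal.ofReal s) P) (ha : 0 < a) (has : 2 * a < s - 1) :
    ∀ᶠ N : ℕ in atTop,
      P.real {ω | (N : ℝ) ^ (-a) < |meanN (fun i : Fin N => X i ω) - ∫ ω, X 0 ω ∂P|} ≤
        5 * (∫ ω, |X 0 ω| ^ s ∂P) * (N : ℝ) ^ (-(s - 1 - 2 * a)) := by
  set m := ∫ ω, |X 0 ω| ^ s ∂P
  have hlim : Tendsto (fun N : ℕ => 2 * m * (N : ℝ) ^ (-(s - 1 - a))) atTop (nhds 0) := by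
    simpa using (tendsto_natCast_rpow_neg (by linarith : 0 < s - 1 - a)).const_mul (2 * m)
  filter_upwards [eventually_ge_atTop 1, hlim.eventually_le_const one_pos] with N hN hNlim
  have hN1 : (1 : ℝ) ≤ N := by exact_mod_cast hN
  have hN0 : (0 : ℝ) < N := by positivity
  have hδ : 2 * (m * (N : ℝ) ^ (1 - s)) ≤ (N : ℝ) ^ (-a) :=
    calc 2 * (m * (N : ℝ) ^ (1 - s))
      _ = 2 * m * (N : ℝ) ^ (-(s - 1 - a)) * (N : ℝ) ^ (-a) := by
          rw [show 1 - s = -(s - 1 - a) + -a by ring, Real.rpow_add hN0]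
          ring
      _ ≤ (N : ℝ) ^ (-a) := mul_le_of_le_one_left (by positivity) hNlim
  have hpow : 1 + 4 / ((N : ℝ) ^ (-a)) ^ 2 ≤ 5 * (N : ℝ) ^ (2 * a) := by
    have hinv : ((N : ℝ) ^ (-a)) ^ 2 = ((N : ℝ) ^ (2 * a))⁻¹ := by
      rw [← Real.rpow_mul_natCast hN0.le, ← Real.rpow_neg hN0.le]
      congr 1
      push_cast
      ring
    rw [hinv, div_inv_eq_mul]
    linarith [Real.one_le_rpow hN1 (by linarith : 0 ≤ 2 * a)]
  calc P.real {ω | (N : ℝ) ^ (-a) < |meanN (fun i : Fin N => X i ω) - ∫ ω, X 0 ω ∂P|}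
    _ ≤ m * (N : ℝ) ^ (1 - s) * (1 + 4 / ((N : ℝ) ^ (-a)) ^ 2) :=
        measureReal_lt_abs_meanN_sub_integral_le hindep hident (by linarith) hs hX (by lia)
          (by positivity) hδ
    _ ≤ m * (N : ℝ) ^ (1 - s) * (5 * (N : ℝ) ^ (2 * a)) := by gcongr
    _ = 5 * m * (N : ℝ) ^ (-(s - 1 - 2 * a)) := by
        rw [show -(s - 1 - 2 * a) = 1 - s + 2 * a by ring, Real.rpow_add hN0]
        ring

end LawOfLargeNumbers

section EmpiricalMeans

variable {Ω : Type*} [MeasurableSpace Ω] {P : Measure Ω} [IsProbabilityMeasure P]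
  {L : ℕ → Ω → ℝ}

lemma measurable_meanN_comp {h : ℝ → ℝ} (hh : Measurable h) (N : ℕ) :
    Measurable fun x : Fin N → ℝ => meanN fun i => h (x i) := by
  unfold meanN
  fun_prop

theorem holdsWithHighProb_meanN_sub_integral_isBigO
    (hindep : Pairwise fun i j => L i ⟂ᵢ[P] L j)
    (hident : ∀ i, IdentDistrib (L i) (L 0) P P) {h : ℝ → ℝ} (hh : Measurable h) {s a : ℝ}
    (hs : s ≤ 2) (hmem : MemLp (fun ω => h (L 0 ω)) (ENNReal.ofReal s) P)
    (ha : 0 < a) (has : 2 * a < s - 1) :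
    HoldsWithHighProb P L fun lam =>
      (fun N => meanN (fun i => h (lam N i)) - ∫ ω, h (L 0 ω) ∂P)
        =O[atTop] fun N : ℕ => (N : ℝ) ^ (-a) := by
  let J (N : ℕ) : Set (Fin N → ℝ) :=
    {x | |meanN (fun i => h (x i)) - ∫ ω, h (L 0 ω) ∂P| ≤ (N : ℝ) ^ (-a)}
  have hJ (N : ℕ) : MeasurableSet (J N) :=
    measurableSet_le ((measurable_meanN_comp hh N).sub_const _).norm measurable_const
  have hprob : HoldsWithHighProb P L fun lam => ∀ᶠ N in atTop, lam N ∈ J N := by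
    refine .of_measureReal_notMem_le (fun i => (hident i).aemeasurable_fst) hJ
      (by linarith : 0 < s - 1 - 2 * a) (5 * ∫ ω, |h (L 0 ω)| ^ s ∂P) ?_
    simp only [J, Set.mem_ofPred_eq, not_le]
    exact eventually_measureReal_rpow_lt_abs_meanN_sub_integral_le (X := fun i ω => h (L i ω))
      (fun i j hij => (hindep hij).comp hh hh) (fun i => (hident i).comp hh) hs hmem ha has
  refine hprob.mono fun lam _ hlam => .of_bound 1 ?_
  filter_upwards [hlam] with N hN
  rwa [one_mul, Real.norm_of_nonneg (by positivity : (0 : ℝ) ≤ (N : ℝ) ^ (-a))]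

theorem exists_holdsWithHighProb_meanN_rpow_sub_integral_isBigO
    (hindep : Pairwise fun i j => L i ⟂ᵢ[P] L j)
    (hident : ∀ i, IdentDistrib (L i) (L 0) P P) (hnonneg : 0 ≤ᵐ[P] L 0) {p q : ℝ}
    (hp : 0 < p) (hpq : p < q) (hmem : MemLp (L 0) (ENNReal.ofReal q) P) :
    ∃ a : ℝ, 0 < a ∧ HoldsWithHighProb P L fun lam =>
      (fun N => meanN (fun i => lam N i ^ p) - ∫ ω, L 0 ω ^ p ∂P)
        =O[atTop] fun N : ℕ => (N : ℝ) ^ (-a) := by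
  set s : ℝ := min 2 (q / p)
  have hs : 1 < s := lt_min one_lt_two ((one_lt_div hp).2 hpq)
  have hpow : MemLp (fun ω => L 0 ω ^ p) (ENNReal.ofReal s) P := by
    refine .mono_exponent (.ae_eq ?_ (memLp_abs_rpow hp hmem))
      (ENNReal.ofReal_le_ofReal (min_le_right _ _))
    filter_upwards [hnonneg] with ω hω
    rw [abs_of_nonneg hω]
  exact ⟨(s - 1) / 4, by linarith, holdsWithHighProb_meanN_sub_integral_isBigO hindep hident
    (measurable_id.pow_const p) (min_le_left _ _) hpow (by linarith) (by linarith)⟩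

lemma holdsWithHighProb_meanN_rpow_isBigO_one
    (hindep : Pairwise fun i j => L i ⟂ᵢ[P] L j)
    (hident : ∀ i, IdentDistrib (L i) (L 0) P P) (hnonneg : 0 ≤ᵐ[P] L 0) {p q : ℝ}
    (hp : 0 < p) (hpq : p < q) (hmem : MemLp (L 0) (ENNReal.ofReal q) P) :
    HoldsWithHighProb P L fun lam =>
      (fun N => meanN fun i => lam N i ^ p) =O[atTop] fun _ => (1 : ℝ) :=
  let ⟨_, ha, hprob⟩ :=
    exists_holdsWithHighProb_meanN_rpow_sub_integral_isBigO hindep hident hnonneg hp hpq hmem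
  hprob.mono fun _ _ h => isBigO_one_of_isBigO_sub_const h (tendsto_natCast_rpow_neg ha)

theorem holdsWithHighProb_forall_le_rpow
    (hident : ∀ i, IdentDistrib (L i) (L 0) P P) {C κ γ : ℝ}
    (htail : ∀ t : ℝ, 0 < t → P.real {ω | t < L 0 ω} ≤ C * t ^ (-κ)) (hγ : 1 < γ * κ) :
    HoldsWithHighProb P L fun lam => ∀ᶠ N : ℕ in atTop, ∀ i, lam N i ≤ (N : ℝ) ^ γ := by
  refine .of_measureReal_notMem_le (J := fun N => {x | ∀ i, x i ≤ (N : ℝ) ^ γ})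
    (fun i => (hident i).aemeasurable_fst) (fun N => ?_) (by linarith : 0 < γ * κ - 1) C ?_
  · exact measurableSet_le measurable_id measurable_const
  filter_upwards [eventually_ge_atTop 1] with N hN
  have hN0 : (0 : ℝ) < N := by positivity
  simp only [not_forall, not_le]
  calc P.real {ω | ∃ i : Fin N, (N : ℝ) ^ γ < L i ω}
    _ ≤ N * P.real {ω | (N : ℝ) ^ γ < L 0 ω} :=
        measureReal_exists_fin_mem_le hident measurableSet_Ioi N
    _ ≤ N * (C * ((N : ℝ) ^ γ) ^ (-κ)) := by
        gcongr
        exact htail _ (by positivity)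
    _ = C * (N : ℝ) ^ (-(γ * κ - 1)) := by
        rw [← Real.rpow_mul hN0.le, show -(γ * κ - 1) = 1 + γ * -κ by ring,
          Real.rpow_add hN0, Real.rpow_one]
        ring

lemma measureReal_exists_lt_abs_meanN_sub_integral_le
    (hindep : Pairwise fun i j => L i ⟂ᵢ[P] L j)
    (hident : ∀ i, IdentDistrib (L i) (L 0) P P) {h : ℕ → ℝ → ℝ} (hh : ∀ n, Measurable (h n))
    (hmem : ∀ n, MemLp (fun ω => h n (L 0 ω)) 2 P) {m : ℝ}
    (hm : ∀ n, Var[fun ω => h n (L 0 ω); P] ≤ m) (M : ℕ) {N : ℕ} (hN : N ≠ 0) {δ : ℝ}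
    (hδ : 0 < δ) :
    P.real {ω | ∃ n < M, δ < |meanN (fun i : Fin N => h n (L i ω)) - ∫ ω, h n (L 0 ω) ∂P|} ≤
      M * (m / (N * δ ^ 2)) := by
  have hsingle (n : ℕ) :
      P.real {ω | δ < |meanN (fun i : Fin N => h n (L i ω)) - ∫ ω, h n (L 0 ω) ∂P|} ≤
        m / (N * δ ^ 2) :=
    calc P.real {ω | δ < |meanN (fun i : Fin N => h n (L i ω)) - ∫ ω, h n (L 0 ω) ∂P|}
      _ ≤ P.real {ω | δ ≤ |meanN (fun i : Fin N => h n (L i ω)) - ∫ ω, h n (L 0 ω) ∂P|} :=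
          measureReal_mono (Set.ofPred_subset_ofPred.2 fun _ => le_of_lt)
      _ ≤ Var[fun ω => h n (L 0 ω); P] / (N * δ ^ 2) :=
          measureReal_le_abs_meanN_sub_integral_le_variance (X := fun i ω => h n (L i ω))
            (fun _ _ hij => (hindep hij).comp (hh n) (hh n)) (fun i => (hident i).comp (hh n))
            (hmem n) hN hδ
      _ ≤ m / (N * δ ^ 2) := by
          gcongr
          exact hm n
  have hunion : {ω | ∃ n < M,
        δ < |meanN (fun i : Fin N => h n (L i ω)) - ∫ ω, h n (L 0 ω) ∂P|} =
      ⋃ n ∈ Finset.range M,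
        {ω | δ < |meanN (fun i : Fin N => h n (L i ω)) - ∫ ω, h n (L 0 ω) ∂P|} := by
    ext ω
    simp
  rw [hunion]
  refine (measureReal_biUnion_finset_le _ _).trans ?_
  simpa using Finset.sum_le_sum fun n (_ : n ∈ Finset.range M) => hsingle n

lemma natCeil_rpow_le_two_mul {r : ℝ} (hr : 0 ≤ r) {N : ℕ} (hN : N ≠ 0) :
    (⌈(N : ℝ) ^ r⌉₊ : ℝ) ≤ 2 * (N : ℝ) ^ r := by
  have hone : 1 ≤ (N : ℝ) ^ r := Real.one_le_rpow (by exact_mod_cast Nat.one_le_iff_ne_zero.2 hN) hr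
  linarith [Nat.ceil_lt_add_one (zero_le_one.trans hone)]

theorem holdsWithHighProb_forall_lt_abs_meanN_sub_integral_le
    (hindep : Pairwise fun i j => L i ⟂ᵢ[P] L j)
    (hident : ∀ i, IdentDistrib (L i) (L 0) P P) {h : ℕ → ℝ → ℝ} (hh : ∀ n, Measurable (h n))
    (hmem : ∀ n, MemLp (fun ω => h n (L 0 ω)) 2 P) {m : ℝ}
    (hm : ∀ n, Var[fun ω => h n (L 0 ω); P] ≤ m) {r : ℝ} (hr : 0 ≤ r) (hr5 : 5 * r < 1) :
    HoldsWithHighProb P L fun lam => ∀ᶠ N : ℕ in atTop, ∀ n < ⌈(N : ℝ) ^ r⌉₊,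
      |meanN (fun i => h n (lam N i)) - ∫ ω, h n (L 0 ω) ∂P| ≤ (N : ℝ) ^ (-(2 * r)) := by
  have hm0 : 0 ≤ m := (variance_nonneg _ _).trans (hm 0)
  refine .of_measureReal_notMem_le
    (J := fun N => {x | ∀ n < ⌈(N : ℝ) ^ r⌉₊,
      |meanN (fun i => h n (x i)) - ∫ ω, h n (L 0 ω) ∂P| ≤ (N : ℝ) ^ (-(2 * r))})
    (fun i => (hident i).aemeasurable_fst) (fun N => ?_) (by linarith : 0 < 1 - 5 * r) (2 * m) ?_
  · simp only [Set.ofPred_forall]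
    exact .iInter fun n => .iInter fun _ =>
      measurableSet_le ((measurable_meanN_comp (hh n) N).sub_const _).norm measurable_const
  filter_upwards [eventually_ne_atTop 0] with N hN
  have hN0 : (0 : ℝ) < N := by positivity
  simp only [not_forall, not_le, exists_prop]
  calc _ ≤ (⌈(N : ℝ) ^ r⌉₊ : ℝ) * (m / (N * ((N : ℝ) ^ (-(2 * r))) ^ 2)) :=
        measureReal_exists_lt_abs_meanN_sub_integral_le hindep hident hh hmem hm _ hN
          (by positivity)
    _ ≤ 2 * (N : ℝ) ^ r * (m / (N * ((N : ℝ) ^ (-(2 * r))) ^ 2)) := by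
        gcongr
        exact natCeil_rpow_le_two_mul hr hN
    _ = 2 * m * ((N : ℝ) ^ r / (N * ((N : ℝ) ^ (-(2 * r))) ^ 2)) := by ring
    _ = 2 * m * (N : ℝ) ^ (-(1 - 5 * r)) := by
        congr 1
        rw [← Real.rpow_mul_natCast hN0.le, ← Real.rpow_one_add' hN0.le, ← Real.rpow_sub hN0]
        · congr 1
          push_cast
          ring
        · exact (by push_cast; linarith : 0 < 1 + -(2 * r) * (2 : ℕ)).ne'

end EmpiricalMeans

section SumOfAbsoluteDifferences

lemma tsum_abs_div_sub_div_le {ι : Type*} {a b : ι → ℝ} {A B : ℝ} (ha : ∀ n, 0 ≤ a n)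
    (hA : HasSum a A) (hB : HasSum b B) (hA0 : 0 < A) (hB0 : 0 < B) :
    ∑' n, |a n / A - b n / B| ≤ 2 / B * ∑' n, |a n - b n| := by
  have hab : Summable fun n => |a n - b n| := (hA.summable.sub hB.summable).abs
  have hAB : |A - B| ≤ ∑' n, |a n - b n| :=
    (hA.sub hB).norm_le_of_bounded hab.hasSum fun _ => le_rfl
  have hle (n : ι) : |a n / A - b n / B| ≤ |a n - b n| / B + a n * (|A - B| / (A * B)) := by
    have hsplit : a n / A - b n / B = (a n - b n) / B - a n * ((A - B) / (A * B)) := by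
      field_simp
      ring
    rw [hsplit]
    refine (abs_sub _ _).trans_eq ?_
    rw [abs_div, abs_mul, abs_div, abs_of_pos hB0, abs_of_nonneg (ha n),
      abs_of_pos (mul_pos hA0 hB0)]
  calc ∑' n, |a n / A - b n / B|
    _ ≤ (∑' n, |a n - b n|) / B + A * (|A - B| / (A * B)) :=
        hasSum_le hle (hA.summable.div_const A |>.sub (hB.summable.div_const B)).abs.hasSum
          ((hab.hasSum.div_const B).add (hA.mul_right _))
    _ = (∑' n, |a n - b n| + |A - B|) / B := by field_simp
    _ ≤ 2 / B * ∑' n, |a n - b n| := by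
        rw [div_mul_eq_mul_div]
        gcongr
        linarith

lemma tsum_abs_sub_le_of_forall_lt {a b : ℕ → ℝ} (ha : ∀ n, 0 ≤ a n) (hb : ∀ n, 0 ≤ b n)
    {A B : ℝ} (hA : HasSum (fun n : ℕ => n * a n) A) (hB : HasSum (fun n : ℕ => n * b n) B)
    {M : ℕ} (hM : M ≠ 0) {δ : ℝ} (hδ : ∀ n < M, |a n - b n| ≤ δ) :
    ∑' n, |a n - b n| ≤ M * δ + (A + B) / M := by
  have hM0 : (0 : ℝ) < M := by positivity
  have hsum : HasSum (fun n : ℕ => (if n < M then δ else 0) + (n * a n + n * b n) / M)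
      (M * δ + (A + B) / M) := by
    refine .add ?_ ((hA.add hB).div_const _)
    have := hasSum_sum_of_ne_finset_zero (f := fun n : ℕ => if n < M then δ else 0)
      (s := Finset.range M) (L := .unconditional ℕ) fun n hn => if_neg (Finset.mem_range.not.1 hn)
    rwa [Finset.sum_congr rfl fun n hn => if_pos (Finset.mem_range.1 hn), Finset.sum_const,
      Finset.card_range, nsmul_eq_mul] at this
  have hle (n : ℕ) :
      |a n - b n| ≤ (if n < M then δ else 0) + (n * a n + n * b n) / M := by
    have han := ha n
    have hbn := hb n
    split_ifs with hn
    · exact (hδ n hn).trans (le_add_of_nonneg_right (by positivity))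
    · have hMn : (M : ℝ) ≤ n := by exact_mod_cast not_lt.1 hn
      rw [zero_add, le_div_iff₀' hM0, ← mul_add]
      exact mul_le_mul hMn (abs_le.2 ⟨by linarith, by linarith⟩) (abs_nonneg _) (by positivity)
  exact hasSum_le hle (Summable.of_nonneg_of_le (fun _ => abs_nonneg _) hle hsum.summable).hasSum
    hsum

lemma isBigO_tsum_abs_sub {a : ℕ → ℕ → ℝ} {b : ℕ → ℝ} (ha : ∀ N n, 0 ≤ a N n) (hb : ∀ n, 0 ≤ b n)
    {A : ℕ → ℝ} {B : ℝ} (hA : ∀ N, HasSum (fun n : ℕ => n * a N n) (A N))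
    (hB : HasSum (fun n : ℕ => n * b n) B) (hAbdd : A =O[atTop] fun _ => (1 : ℝ)) {r : ℝ}
    (hr : 0 ≤ r) (hclose : ∀ᶠ N : ℕ in atTop, ∀ n < ⌈(N : ℝ) ^ r⌉₊,
      |a N n - b n| ≤ (N : ℝ) ^ (-(2 * r))) :
    (fun N => ∑' n, |a N n - b n|) =O[atTop] fun N : ℕ => (N : ℝ) ^ (-r) := by
  have hbound : ∀ᶠ N : ℕ in atTop,
      ‖∑' n, |a N n - b n|‖ ≤ (A N + (2 + B)) * (N : ℝ) ^ (-r) := by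
    filter_upwards [hclose, eventually_ne_atTop 0] with N hN hN0
    have hN' : (0 : ℝ) < N := by positivity
    have hceil : 0 < ⌈(N : ℝ) ^ r⌉₊ := Nat.ceil_pos.2 (by positivity)
    have hAN : 0 ≤ A N := (hA N).nonneg fun n => mul_nonneg n.cast_nonneg (ha N n)
    have hB0 : 0 ≤ B := hB.nonneg fun n => mul_nonneg n.cast_nonneg (hb n)
    rw [Real.norm_of_nonneg (tsum_nonneg fun _ => abs_nonneg _)]
    calc ∑' n, |a N n - b n|
      _ ≤ ⌈(N : ℝ) ^ r⌉₊ * (N : ℝ) ^ (-(2 * r)) + (A N + B) / ⌈(N : ℝ) ^ r⌉₊ :=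
          tsum_abs_sub_le_of_forall_lt (ha N) hb (hA N) hB hceil.ne' hN
      _ ≤ 2 * (N : ℝ) ^ r * (N : ℝ) ^ (-(2 * r)) + (A N + B) / (N : ℝ) ^ r := by
          gcongr
          · exact natCeil_rpow_le_two_mul hr hN0
          · exact Nat.le_ceil _
      _ = (A N + (2 + B)) * (N : ℝ) ^ (-r) := by
          rw [mul_assoc, ← Real.rpow_add hN', show r + -(2 * r) = -r by ring, div_eq_mul_inv,
            ← Real.rpow_neg hN'.le]
          ring
  refine (IsBigO.of_norm_eventuallyLE hbound).trans ?_
  simpa only [one_mul] using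
    (hAbdd.add (isBigO_const_const (2 + B) one_ne_zero _)).mul (isBigO_refl _ _)

end SumOfAbsoluteDifferences

section Poisson

/-- The probability `e^{-x} x^n / n!` of the value `n` under the Poisson law with mean `x ≥ 0`;
it is a function of a real argument so that `f_n` and `g_n` are averages of functions of the
capacities. -/
def poissonWeight (n : ℕ) (x : ℝ) : ℝ := Real.exp (-x) * x ^ n / n.factorial

@[fun_prop]
lemma measurable_poissonWeight (n : ℕ) : Measurable (poissonWeight n) := by
  unfold poissonWeight
  fun_prop

variable {x : ℝ}

lemma poissonWeight_nonneg (hx : 0 ≤ x) (n : ℕ) : 0 ≤ poissonWeight n x := by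
  unfold poissonWeight
  positivity

lemma hasSum_poissonWeight (hx : 0 ≤ x) : HasSum (fun n => poissonWeight n x) 1 :=
  hasSum_one_poissonMeasure ⟨x, hx⟩

lemma poissonWeight_le_one (hx : 0 ≤ x) (n : ℕ) : poissonWeight n x ≤ 1 :=
  le_hasSum (hasSum_poissonWeight hx) n fun k _ => poissonWeight_nonneg hx k

lemma succ_mul_poissonWeight_succ (n : ℕ) (x : ℝ) :
    ((n + 1 : ℕ) : ℝ) * poissonWeight (n + 1) x = x * poissonWeight n x := by
  simp only [poissonWeight, Nat.factorial_succ, Nat.cast_mul, pow_succ']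
  field_simp

lemma hasSum_natCast_mul_poissonWeight (hx : 0 ≤ x) :
    HasSum (fun n : ℕ => n * poissonWeight n x) x := by
  rw [← hasSum_nat_add_iff' 1]
  simp only [succ_mul_poissonWeight_succ, Finset.sum_range_one, Nat.cast_zero, zero_mul, sub_zero]
  simpa using (hasSum_poissonWeight hx).mul_left x

end Poisson

section MixedPoisson

lemma mul_meanN {N : ℕ} (c : ℝ) (x : Fin N → ℝ) : c * meanN x = meanN fun i => c * x i := by
  simp only [meanN, mul_left_comm c, Finset.mul_sum]

lemma meanN_pos {N : ℕ} (hN : N ≠ 0) {x : Fin N → ℝ} (hx : ∀ i, 0 < x i) : 0 < meanN x := by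
  have : NeZero N := ⟨hN⟩
  exact mul_pos (by positivity) (Finset.sum_pos (fun i _ => hx i) Finset.univ_nonempty)

lemma meanN_nonneg {N : ℕ} {x : Fin N → ℝ} (hx : ∀ i, 0 ≤ x i) : 0 ≤ meanN x :=
  mul_nonneg (by positivity) (Finset.sum_nonneg fun i _ => hx i)

lemma hasSum_meanN {N : ℕ} {F : ℕ → Fin N → ℝ} {S : Fin N → ℝ}
    (hF : ∀ i, HasSum (fun n => F n i) (S i)) : HasSum (fun n => meanN (F n)) (meanN S) :=
  (hasSum_sum fun i _ => hF i).mul_left _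

variable {Ω : Type*} [MeasurableSpace Ω] {P : Measure Ω}

lemma hasSum_integral_of_nonneg {F : ℕ → Ω → ℝ} {S : Ω → ℝ}
    (hF : ∀ n, AEStronglyMeasurable (F n) P) (hF0 : ∀ n, 0 ≤ᵐ[P] F n) (hS : Integrable S P)
    (hsum : ∀ᵐ ω ∂P, HasSum (fun n => F n ω) (S ω)) :
    HasSum (fun n => ∫ ω, F n ω ∂P) (∫ ω, S ω ∂P) := by
  refine hasSum_integral_of_dominated_convergence F hF (fun n => ?_)
    (hsum.mono fun _ h => h.summable) (hS.congr (hsum.mono fun _ h => h.tsum_eq.symm)) hsum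
  filter_upwards [hF0 n] with ω hω
  exact (Real.norm_of_nonneg hω).le

variable {w : ℝ → ℝ} {Y : Ω → ℝ}

lemma hasSum_meanN_mul_poissonWeight (w : ℝ → ℝ) {N : ℕ} {x : Fin N → ℝ} (hx : ∀ i, 0 ≤ x i) :
    HasSum (fun n => meanN fun i => w (x i) * poissonWeight n (x i))
      (meanN fun i => w (x i)) := by
  simpa only [mul_one] using hasSum_meanN fun i => (hasSum_poissonWeight (hx i)).mul_left (w (x i))

lemma hasSum_natCast_mul_meanN_mul_poissonWeight (w : ℝ → ℝ) {N : ℕ} {x : Fin N → ℝ}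
    (hx : ∀ i, 0 ≤ x i) :
    HasSum (fun n : ℕ => n * meanN fun i => w (x i) * poissonWeight n (x i))
      (meanN fun i => w (x i) * x i) := by
  simp only [mul_meanN, mul_left_comm _ (w _)]
  exact hasSum_meanN fun i => (hasSum_natCast_mul_poissonWeight (hx i)).mul_left (w (x i))

lemma aestronglyMeasurable_mul_poissonWeight (hw : Measurable w) (hY : AEMeasurable Y P) (n : ℕ) :
    AEStronglyMeasurable (fun ω => w (Y ω) * poissonWeight n (Y ω)) P :=
  ((hw.mul (measurable_poissonWeight n)).comp_aemeasurable hY).aestronglyMeasurable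

lemma hasSum_integral_mul_poissonWeight (hw : Measurable w) (hw0 : ∀ y, 0 ≤ y → 0 ≤ w y)
    (hY : AEMeasurable Y P) (hY0 : 0 ≤ᵐ[P] Y) (hwY : Integrable (fun ω => w (Y ω)) P) :
    HasSum (fun n => ∫ ω, w (Y ω) * poissonWeight n (Y ω) ∂P) (∫ ω, w (Y ω) ∂P) := by
  refine hasSum_integral_of_nonneg (aestronglyMeasurable_mul_poissonWeight hw hY)
    (fun n => ?_) hwY ?_
  · filter_upwards [hY0] with ω hω
    exact mul_nonneg (hw0 _ hω) (poissonWeight_nonneg hω n)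
  · filter_upwards [hY0] with ω hω
    simpa only [mul_one] using (hasSum_poissonWeight hω).mul_left (w (Y ω))

lemma hasSum_natCast_mul_integral_mul_poissonWeight (hw : Measurable w)
    (hw0 : ∀ y, 0 ≤ y → 0 ≤ w y) (hY : AEMeasurable Y P) (hY0 : 0 ≤ᵐ[P] Y)
    (hwY : Integrable (fun ω => w (Y ω) * Y ω) P) :
    HasSum (fun n : ℕ => n * ∫ ω, w (Y ω) * poissonWeight n (Y ω) ∂P)
      (∫ ω, w (Y ω) * Y ω ∂P) := by
  simp only [← integral_const_mul]
  refine hasSum_integral_of_nonneg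
    (fun n => (aestronglyMeasurable_mul_poissonWeight hw hY n).const_mul _) (fun n => ?_) hwY ?_
  · filter_upwards [hY0] with ω hω
    exact mul_nonneg n.cast_nonneg (mul_nonneg (hw0 _ hω) (poissonWeight_nonneg hω n))
  · filter_upwards [hY0] with ω hω
    simpa only [mul_left_comm _ (w _)] using
      (hasSum_natCast_mul_poissonWeight hω).mul_left (w (Y ω))

lemma memLp_mul_poissonWeight {p : ENNReal} (hw : Measurable w) (hY : AEMeasurable Y P)
    (hY0 : 0 ≤ᵐ[P] Y) (hwY : MemLp (fun ω => w (Y ω)) p P) (n : ℕ) :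
    MemLp (fun ω => w (Y ω) * poissonWeight n (Y ω)) p P := by
  refine hwY.of_le (aestronglyMeasurable_mul_poissonWeight hw hY n) ?_
  filter_upwards [hY0] with ω hω
  rw [norm_mul, Real.norm_of_nonneg (poissonWeight_nonneg hω n)]
  exact mul_le_of_le_one_right (norm_nonneg _) (poissonWeight_le_one hω n)

lemma variance_mul_poissonWeight_le [IsProbabilityMeasure P] (hw : Measurable w)
    (hY : AEMeasurable Y P) (hY0 : 0 ≤ᵐ[P] Y) (hwY : MemLp (fun ω => w (Y ω)) 2 P) (n : ℕ) :
    Var[fun ω => w (Y ω) * poissonWeight n (Y ω); P] ≤ ∫ ω, w (Y ω) ^ 2 ∂P := by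
  refine (variance_le_expectation_sq (aestronglyMeasurable_mul_poissonWeight hw hY n)).trans ?_
  refine integral_mono_ae (memLp_mul_poissonWeight hw hY hY0 hwY n).integrable_sq
    hwY.integrable_sq ?_
  filter_upwards [hY0] with ω hω
  simp only [Pi.pow_apply, mul_pow]
  exact mul_le_of_le_one_right (sq_nonneg _)
    (pow_le_one₀ (poissonWeight_nonneg hω n) (poissonWeight_le_one hω n))

variable [IsProbabilityMeasure P] {L : ℕ → Ω → ℝ}

theorem holdsWithHighProb_tsum_abs_meanN_mul_poissonWeight_sub_isBigO
    (hindep : Pairwise fun i j => L i ⟂ᵢ[P] L j)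
    (hident : ∀ i, IdentDistrib (L i) (L 0) P P) (hnonneg : 0 ≤ᵐ[P] L 0)
    (hw : Measurable w) (hw0 : ∀ y, 0 ≤ y → 0 ≤ w y) (hw2 : MemLp (fun ω => w (L 0 ω)) 2 P)
    (hw1 : Integrable (fun ω => w (L 0 ω) * L 0 ω) P)
    (hbdd : HoldsWithHighProb P L fun lam =>
      (fun N => meanN fun i => w (lam N i) * lam N i) =O[atTop] fun _ => (1 : ℝ))
    {r : ℝ} (hr : 0 ≤ r) (hr5 : 5 * r < 1) :
    HoldsWithHighProb P L fun lam =>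
      (fun N => ∑' n, |meanN (fun i => w (lam N i) * poissonWeight n (lam N i)) -
        ∫ ω, w (L 0 ω) * poissonWeight n (L 0 ω) ∂P|) =O[atTop] fun N : ℕ => (N : ℝ) ^ (-r) := by
  have hmeas (i : ℕ) : AEMeasurable (L i) P := (hident i).aemeasurable_fst
  have hclose := holdsWithHighProb_forall_lt_abs_meanN_sub_integral_le hindep hident
    (h := fun n y => w y * poissonWeight n y) (fun n => hw.mul (measurable_poissonWeight n))
    (memLp_mul_poissonWeight hw (hmeas 0) hnonneg hw2)
    (variance_mul_poissonWeight_le hw (hmeas 0) hnonneg hw2) hr hr5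
  refine (hclose.and hmeas hbdd).mono fun lam hlam ⟨hlam_close, hlam_bdd⟩ => ?_
  refine isBigO_tsum_abs_sub (fun N n => meanN_nonneg fun i =>
      mul_nonneg (hw0 _ (hlam N i).le) (poissonWeight_nonneg (hlam N i).le n))
    (fun n => integral_nonneg_of_ae ?_)
    (fun N => hasSum_natCast_mul_meanN_mul_poissonWeight w fun i => (hlam N i).le)
    (hasSum_natCast_mul_integral_mul_poissonWeight hw hw0 (hmeas 0) hnonneg hw1)
    hlam_bdd hr hlam_close
  filter_upwards [hnonneg] with ω hω
  exact mul_nonneg (hw0 _ hω) (poissonWeight_nonneg hω n)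

end MixedPoisson

section Conditions

variable {Ω : Type*} [MeasurableSpace Ω] {P : Measure Ω} {X : Ω → ℝ}

lemma mu_pos_of_nu_ne_zero (hX : 0 ≤ᵐ[P] X) (hν : nu P X ≠ 0) : 0 < mu P X :=
  (integral_nonneg_of_ae hX).lt_of_ne' fun h => hν (by rw [nu, h, div_zero])

lemma nuN_eq_div {N : ℕ} (hN : N ≠ 0) (x : Fin N → ℝ) :
    nuN x = meanN (fun i => x i ^ 2) / meanN x := by
  have : (1 / (N : ℝ)) ≠ 0 := by positivity
  exact (mul_div_mul_left _ _ this).symm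

lemma gN_eq_div {N : ℕ} (x : Fin N → ℝ) :
    gN x = fun n => (meanN fun i => x i * poissonWeight n (x i)) / meanN x := by
  funext n
  have hterm (i : Fin N) : Real.exp (-x i) * x i ^ (n + 1) / n.factorial =
      x i * poissonWeight n (x i) := by
    rw [poissonWeight, pow_succ]
    ring
  simp only [gN, hterm, ← div_div, one_div, meanN]
  ring

lemma fLim_eq_integral : fLim P X = fun n => ∫ ω, poissonWeight n (X ω) ∂P := rfl

lemma gLim_eq_div :
    gLim P X = fun n => (∫ ω, X ω * poissonWeight n (X ω) ∂P) / mu P X := by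
  funext n
  have hterm (ω : Ω) : Real.exp (-X ω) * X ω ^ (n + 1) / n.factorial =
      X ω * poissonWeight n (X ω) := by
    rw [poissonWeight, pow_succ]
    ring
  simp only [gLim, hterm, div_eq_inv_mul, mul_one]

lemma isProbMass_fLim [IsProbabilityMeasure P] (hX : AEMeasurable X P) (hX0 : 0 ≤ᵐ[P] X) :
    IsProbMass (fLim P X) := by
  rw [fLim_eq_integral]
  refine ⟨fun n => integral_nonneg_of_ae (hX0.mono fun ω hω => poissonWeight_nonneg hω n), ?_⟩
  simpa using hasSum_integral_mul_poissonWeight (w := fun _ => 1) measurable_const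
    (fun _ _ => zero_le_one) hX hX0 (integrable_const (1 : ℝ))

lemma hasSum_integral_self_mul_poissonWeight (hX : Integrable X P) (hX0 : 0 ≤ᵐ[P] X) :
    HasSum (fun n => ∫ ω, X ω * poissonWeight n (X ω) ∂P) (mu P X) :=
  hasSum_integral_mul_poissonWeight measurable_id (fun _ h => h) hX.aemeasurable hX0 hX

lemma isProbMass_gLim (hX : Integrable X P) (hX0 : 0 ≤ᵐ[P] X) (hμ : 0 < mu P X) :
    IsProbMass (gLim P X) := by
  rw [gLim_eq_div]
  refine ⟨fun n => div_nonneg (integral_nonneg_of_ae ?_) hμ.le, ?_⟩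
  · filter_upwards [hX0] with ω hω
    exact mul_nonneg hω (poissonWeight_nonneg hω n)
  · simpa only [div_self hμ.ne'] using
      (hasSum_integral_self_mul_poissonWeight hX hX0).div_const (mu P X)

lemma dTV_nonneg (p q : ℕ → ℝ) : 0 ≤ dTV p q :=
  mul_nonneg (by norm_num) (tsum_nonneg fun _ => abs_nonneg _)

lemma dTV_gN_gLim_le (hX : Integrable X P) (hX0 : 0 ≤ᵐ[P] X) (hμ : 0 < mu P X) {N : ℕ}
    (hN : N ≠ 0) {x : Fin N → ℝ} (hx : ∀ i, 0 < x i) :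
    dTV (gN x) (gLim P X) ≤
      1 / mu P X * ∑' n, |meanN (fun i => x i * poissonWeight n (x i)) -
        ∫ ω, X ω * poissonWeight n (X ω) ∂P| := by
  have h := tsum_abs_div_sub_div_le
    (fun n => meanN_nonneg fun i => mul_nonneg (hx i).le (poissonWeight_nonneg (hx i).le n))
    (hasSum_meanN_mul_poissonWeight (fun y => y) fun i => (hx i).le)
    (hasSum_integral_self_mul_poissonWeight hX hX0) (meanN_pos hN hx) hμ
  rw [dTV, gN_eq_div, gLim_eq_div]
  calc _ ≤ 1 / 2 * _ := mul_le_mul_of_nonneg_left h (by norm_num)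
    _ = _ := by ring

lemma condC3At_of_isBigO {lam : Capacities} (hlam : ∀ N i, 0 ≤ lam N i) {q γ τ ε : ℝ}
    (hε : 0 ≤ τ - 1 - ε) (hq : τ - 1 - ε ≤ q) (hγ : γ ≤ 1 / (τ - 1) + ε)
    (hmean : (fun N => meanN fun i => lam N i ^ q) =O[atTop] fun _ => (1 : ℝ))
    (hmax : ∀ᶠ N : ℕ in atTop, ∀ i, lam N i ≤ (N : ℝ) ^ γ) : CondC3At lam τ ε := by
  refine ⟨?_, ?_⟩
  · obtain ⟨C, hC⟩ := hmean.bound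
    have hpow (y : ℝ) (hy : 0 ≤ y) : y ^ (τ - 1 - ε) ≤ 1 + y ^ q := by
      rcases le_total y 1 with h | h
      · linarith [Real.rpow_le_one hy h hε, Real.rpow_nonneg hy q]
      · linarith [Real.rpow_le_rpow_of_exponent_le h hq]
    refine (limsup_le_of_le (a := ((1 + C : ℝ) : EReal)) (by isBoundedDefault) ?_).trans_lt
      (EReal.coe_lt_top _)
    filter_upwards [hC, eventually_ne_atTop 0] with N hN hN0
    rw [EReal.coe_le_coe_iff]
    calc 1 / (N : ℝ) * ∑ i, lam N i ^ (τ - 1 - ε)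
      _ ≤ 1 / (N : ℝ) * ∑ i, (1 + lam N i ^ q) := by
          gcongr with i
          exact hpow _ (hlam N i)
      _ = 1 + meanN fun i => lam N i ^ q := by
          rw [Finset.sum_add_distrib, mul_add, meanN]
          simp [hN0]
      _ ≤ 1 + C := by
          gcongr
          simpa using (le_abs_self _).trans hN
  · filter_upwards [hmax, eventually_ge_atTop 1] with N hN hN1 i
    exact (hN i).trans (Real.rpow_le_rpow_of_exponent_le (by exact_mod_cast hN1) hγ)

variable [IsProbabilityMeasure P] {L : ℕ → Ω → ℝ}

theorem exists_holdsWithHighProb_condC1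
    (hindep : Pairwise fun i j => L i ⟂ᵢ[P] L j)
    (hident : ∀ i, IdentDistrib (L i) (L 0) P P) (hnonneg : 0 ≤ᵐ[P] L 0) {q : ℝ} (hq : 2 < q)
    (hmem : MemLp (L 0) (ENNReal.ofReal q) P) (hν : 1 < nu P (L 0)) :
    ∃ α : ℝ, 0 < α ∧
      HoldsWithHighProb P L fun lam => CondC1 lam (mu P (L 0)) (nu P (L 0)) α := by
  have hμ : 0 < mu P (L 0) := mu_pos_of_nu_ne_zero hnonneg (by linarith)
  obtain ⟨a, ha, hmean⟩ := exists_holdsWithHighProb_meanN_rpow_sub_integral_isBigO hindep hident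
    hnonneg one_pos (by linarith) hmem
  obtain ⟨b, hb, hsq⟩ := exists_holdsWithHighProb_meanN_rpow_sub_integral_isBigO hindep hident
    hnonneg two_pos hq hmem
  simp only [Real.rpow_one] at hmean
  simp only [Real.rpow_two] at hsq
  refine ⟨min a b, lt_min ha hb,
    (hmean.and (fun i => (hident i).aemeasurable_fst) hsq).mono fun lam _ ⟨h1, h2⟩ => ?_⟩
  replace h1 := h1.trans (isBigO_natCast_rpow_neg_of_le (min_le_left a b))
  replace h2 := h2.trans (isBigO_natCast_rpow_neg_of_le (min_le_right a b))
  refine ⟨hμ, hν, lt_min ha hb, h1.abs_left, IsBigO.abs_left ?_⟩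
  refine (isBigO_div_sub_div hμ.ne' h2 h1 (tendsto_natCast_rpow_neg (lt_min ha hb))).congr' ?_
    EventuallyEq.rfl
  filter_upwards [eventually_ne_atTop 0] with N hN
  rw [nuN_eq_div hN, nu, mu]

theorem holdsWithHighProb_condC2
    (hindep : Pairwise fun i j => L i ⟂ᵢ[P] L j)
    (hident : ∀ i, IdentDistrib (L i) (L 0) P P) (hnonneg : 0 ≤ᵐ[P] L 0) {q : ℝ} (hq : 2 < q)
    (hmem : MemLp (L 0) (ENNReal.ofReal q) P) (hμ : 0 < mu P (L 0)) {r : ℝ} (hr : 0 < r)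
    (hr5 : 5 * r < 1) :
    HoldsWithHighProb P L fun lam => CondC2 lam (fLim P (L 0)) (gLim P (L 0)) r := by
  have hmeas (i : ℕ) : AEMeasurable (L i) P := (hident i).aemeasurable_fst
  have hL2 : MemLp (L 0) 2 P := hmem.mono_exponent (by simpa using hq.le)
  have hL1 : Integrable (L 0) P := hL2.integrable one_le_two
  have hmean := holdsWithHighProb_meanN_rpow_isBigO_one hindep hident hnonneg one_pos
    (by linarith) hmem
  have hsq := holdsWithHighProb_meanN_rpow_isBigO_one hindep hident hnonneg two_pos hq hmem
  simp only [Real.rpow_one] at hmean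
  simp only [Real.rpow_two, sq] at hsq
  have hf := holdsWithHighProb_tsum_abs_meanN_mul_poissonWeight_sub_isBigO (w := fun _ => 1)
    hindep hident hnonneg measurable_const (fun _ _ => zero_le_one) (memLp_const 1)
    (by simpa only [one_mul] using hL1) (by simpa only [one_mul] using hmean) hr.le hr5
  have hg := holdsWithHighProb_tsum_abs_meanN_mul_poissonWeight_sub_isBigO (w := fun y => y)
    hindep hident hnonneg measurable_id (fun _ h => h) hL2
    (by simpa only [sq] using hL2.integrable_sq) hsq hr.le hr5
  simp only [one_mul] at hf
  refine (hf.and hmeas hg).mono fun lam hlam ⟨hlam_f, hlam_g⟩ =>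
    ⟨isProbMass_fLim (hmeas 0) hnonneg, isProbMass_gLim hL1 hnonneg hμ, hr,
      hlam_f.const_mul_left _, .trans (.of_norm_eventuallyLE ?_)
        (hlam_g.const_mul_left (1 / mu P (L 0)))⟩
  filter_upwards [eventually_ne_atTop 0] with N hN
  rw [Real.norm_of_nonneg (dTV_nonneg _ _)]
  exact dTV_gN_gLim_le hL1 hnonneg hμ hN (hlam N)

end Conditions

section Tail

variable {Ω : Type*} [MeasurableSpace Ω] {P : Measure Ω} [IsProbabilityMeasure P]

lemma measureReal_lt_eq_one_sub {X : Ω → ℝ} (hX : AEMeasurable X P) (t : ℝ) :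
    P.real {ω | t < X ω} = 1 - P.real {ω | X ω ≤ t} := by
  rw [← probReal_compl_eq_one_sub₀ (nullMeasurableSet_le hX aemeasurable_const)]
  simp only [Set.compl_ofPred, not_le]

variable {L : ℕ → Ω → ℝ} {C κ q : ℝ}

lemma memLp_of_measureReal_lt_le {X : Ω → ℝ} (hX : AEMeasurable X P) (hX0 : 0 ≤ᵐ[P] X)
    (htail : ∀ t : ℝ, 0 < t → P.real {ω | t < X ω} ≤ C * t ^ (-κ)) (hq : 0 < q) (hqκ : q < κ) :
    MemLp X (ENNReal.ofReal q) P := by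
  refine memLp_of_measureReal_lt_abs_le (C := C) (κ := κ) hX (fun t ht => ?_) hq hqκ
  refine (measureReal_congr ?_).trans_le (htail t ht)
  filter_upwards [hX0] with ω hω
  exact congrArg (t < ·) (abs_of_nonneg hω)

theorem holdsWithHighProb_meanN_rpow_isBigO_one_and_forall_le_rpow
    (hindep : Pairwise fun i j => L i ⟂ᵢ[P] L j)
    (hident : ∀ i, IdentDistrib (L i) (L 0) P P) (hnonneg : 0 ≤ᵐ[P] L 0)
    (htail : ∀ t : ℝ, 0 < t → P.real {ω | t < L 0 ω} ≤ C * t ^ (-κ)) (hq : 0 < q) (hqκ : q < κ)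
    {γ : ℝ} (hγ : 1 < γ * κ) :
    HoldsWithHighProb P L fun lam =>
      ((fun N => meanN fun i => lam N i ^ q) =O[atTop] fun _ => (1 : ℝ)) ∧
        ∀ᶠ N : ℕ in atTop, ∀ i, lam N i ≤ (N : ℝ) ^ γ := by
  have hmeas (i : ℕ) : AEMeasurable (L i) P := (hident i).aemeasurable_fst
  obtain ⟨p, hqp, hpκ⟩ := exists_between hqκ
  exact (holdsWithHighProb_meanN_rpow_isBigO_one hindep hident hnonneg hq hqp
    (memLp_of_measureReal_lt_le (hmeas 0) hnonneg htail (hq.trans hqp) hpκ)).and hmeas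
    (holdsWithHighProb_forall_le_rpow hident htail hγ)

theorem holdsWithHighProb_condC3
    (hindep : Pairwise fun i j => L i ⟂ᵢ[P] L j)
    (hident : ∀ i, IdentDistrib (L i) (L 0) P P) (hnonneg : 0 ≤ᵐ[P] L 0)
    (htail : ∀ t : ℝ, 0 < t → P.real {ω | t < L 0 ω} ≤ C * t ^ (-κ)) {τ : ℝ} (hτ : 3 < τ)
    (hτκ : τ - 1 < κ) :
    HoldsWithHighProb P L fun lam => CondC3 lam τ := by
  have hγ : 1 < 1 / (τ - 1) * κ := by
    rwa [one_div_mul_eq_div, one_lt_div (by linarith)]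
  refine (holdsWithHighProb_meanN_rpow_isBigO_one_and_forall_le_rpow hindep hident hnonneg htail
    (by linarith : 0 < τ - 1) hτκ hγ).mono fun lam hlam ⟨hmean, hmax⟩ => ⟨hτ, fun ε hε hε2 => ?_⟩
  have hτ1 : 0 < 1 / (τ - 1) := one_div_pos.2 (by linarith)
  exact condC3At_of_isBigO (fun N i => (hlam N i).le) (by linarith) (by linarith) (by linarith)
    hmean hmax

theorem holdsWithHighProb_condC3At
    (hindep : Pairwise fun i j => L i ⟂ᵢ[P] L j)
    (hident : ∀ i, IdentDistrib (L i) (L 0) P P) (hnonneg : 0 ≤ᵐ[P] L 0) {τ ε : ℝ}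
    (htail : ∀ t : ℝ, 0 < t → P.real {ω | t < L 0 ω} ≤ C * t ^ (-(τ - 1))) (hε : 0 < ε)
    (hετ : ε < τ - 1) :
    HoldsWithHighProb P L fun lam => CondC3At lam τ ε := by
  have hγ : 1 < (1 / (τ - 1) + ε) * (τ - 1) := by
    rw [add_mul, one_div_mul_cancel (by linarith)]
    exact lt_add_of_pos_right 1 (mul_pos hε (by linarith))
  exact (holdsWithHighProb_meanN_rpow_isBigO_one_and_forall_le_rpow hindep hident hnonneg htail
    (by linarith : 0 < τ - 1 - ε) (by linarith) hγ).mono fun lam hlam ⟨hmean, hmax⟩ =>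
      condC3At_of_isBigO (fun N i => (hlam N i).le) (by linarith) le_rfl le_rfl hmean hmax

end Tail

end CapacityGraph

end

open CapacityGraph in
theorem theorem1p4_general {Ω : Type*} [MeasurableSpace Ω] (P : Measure Ω)
    [IsProbabilityMeasure P] (L : ℕ → Ω → ℝ)
    (hindep : Pairwise fun i j => L i ⟂ᵢ[P] L j)
    (hident : ∀ i, IdentDistrib (L i) (L 0) P P)
    (hnonneg : 0 ≤ᵐ[P] L 0)
    (c τ : ℝ) (hτ : 3 < τ)
    (htail : ∀ x : ℝ, 0 < x → 1 - P.real {ω | L 0 ω ≤ x} ≤ c * x ^ (1 - τ))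
    (hν : 1 < nu P (L 0)) :
    ∃ α₁ α₂ : ℝ, 0 < α₁ ∧ 0 < α₂ ∧
      (∀ τ' : ℝ, 3 < τ' → τ' < τ →
        HoldsWithHighProb P L fun lam =>
          CondC1 lam (mu P (L 0)) (nu P (L 0)) α₁ ∧
          CondC2 lam (fLim P (L 0)) (gLim P (L 0)) α₂ ∧
          CondC3 lam τ') ∧
      (∀ ε : ℝ, 0 < ε → 1 / (τ - 1) + ε < 1 / 2 →
        HoldsWithHighProb P L fun lam =>
          CondC1 lam (mu P (L 0)) (nu P (L 0)) α₁ ∧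
          CondC2 lam (fLim P (L 0)) (gLim P (L 0)) α₂ ∧
          CondC3At lam τ ε) := by
  have hmeas (i : ℕ) : AEMeasurable (L i) P := (hident i).aemeasurable_fst
  have htail' (t : ℝ) (ht : 0 < t) : P.real {ω | t < L 0 ω} ≤ c * t ^ (-(τ - 1)) := by
    rw [measureReal_lt_eq_one_sub (hmeas 0), neg_sub]
    exact htail t ht
  obtain ⟨q, hq, hqτ⟩ := exists_between (by linarith : 2 < τ - 1)
  have hmem : MemLp (L 0) (ENNReal.ofReal q) P :=
    memLp_of_measureReal_lt_le (hmeas 0) hnonneg htail' (by linarith) hqτ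
  obtain ⟨α₁, hα₁, hC1⟩ := exists_holdsWithHighProb_condC1 hindep hident hnonneg hq hmem hν
  have hC2 := holdsWithHighProb_condC2 hindep hident hnonneg hq hmem
    (mu_pos_of_nu_ne_zero hnonneg (by linarith)) (r := 1 / 8) (by norm_num) (by norm_num)
  refine ⟨α₁, 1 / 8, hα₁, by norm_num, fun τ' hτ' hττ' => ?_, fun ε hε hε2 => ?_⟩
  · exact hC1.and hmeas (hC2.and hmeas
      (holdsWithHighProb_condC3 hindep hident hnonneg htail' hτ' (by linarith)))
  · have hτ1 : 0 < 1 / (τ - 1) := one_div_pos.2 (by linarith)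
    exact hC1.and hmeas (hC2.and hmeas
      (holdsWithHighProb_condC3At hindep hident hnonneg htail' hε (by linarith)))

open CapacityGraph in
theorem theorem1p4 {Ω : Type*} [MeasurableSpace Ω] (P : Measure Ω) [IsProbabilityMeasure P]
    (L : ℕ → Ω → ℝ)
    (hmeas : ∀ i, Measurable (L i))
    (hindep : iIndepFun L P)
    (hident : ∀ i, IdentDistrib (L i) (L 0) P P)
    (hpos : ∀ i, ∀ᵐ ω ∂P, 0 < L i ω)
    (c τ : ℝ) (hc : 0 < c) (hτ : 3 < τ)
    (htail : ∀ x : ℝ, 0 < x → 1 - P.real {ω | L 0 ω ≤ x} ≤ c * x ^ (1 - τ))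
    (hν : 1 < nu P (L 0)) :
    ∃ α₁ α₂ : ℝ, 0 < α₁ ∧ 0 < α₂ ∧
      (∀ τ' : ℝ, 3 < τ' → τ' < τ →
        ∃ (J : (N : ℕ) → Set (Fin N → ℝ)) (β : ℝ), 0 < β ∧ HasProbOneSubPoly P L J β ∧
          HoldsOn J (fun lam =>
            CondC1 lam (mu P (L 0)) (nu P (L 0)) α₁ ∧
            CondC2 lam (fLim P (L 0)) (gLim P (L 0)) α₂ ∧
            CondC3 lam τ')) ∧
      (∀ ε : ℝ, 0 < ε → 1 / (τ - 1) + ε < 1 / 2 →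
        ∃ (J : (N : ℕ) → Set (Fin N → ℝ)) (β : ℝ), 0 < β ∧ HasProbOneSubPoly P L J β ∧
          HoldsOn J (fun lam =>
            CondC1 lam (mu P (L 0)) (nu P (L 0)) α₁ ∧
            CondC2 lam (fLim P (L 0)) (gLim P (L 0)) α₂ ∧
            CondC3At lam τ ε)) :=
  theorem1p4_general P L (fun _ _ hij => hindep.indepFun hij) hident
    ((hpos 0).mono fun _ => le_of_lt) c τ hτ htail hν
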